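/- Let $N\ge 2$, $0<s<1<p<N$, and let $\Omega\subset\mathbb R^N$ be a bounded open set with Lipschitz boundary. Let $V\in L^q(\Omega)$ for some $q\in\left(\frac{N}{sp},\infty\right)$, with $V\ge 0$ a.e. in $\Omega$. Let $$X_0^{s,p}(\Omega)=\{u\in W^{1,p}(\mathbb R^N):\ u|_\Omega\in W_0^{1,p}(\Omega),\ u=0 \text{ a.e. in }\mathbb R^N\setminus\Omega\},$$ where $W_0^{1,p}(\Omega)$ is the closure of $C_c^\infty(\Omega)$ in $W^{1,p}(\Omega)$, and for $u,\psi\in X_0^{s,p}(\Omega)$ let $$H_{s,p}(u,\psi)=\int_\Omega|\nabla u|^{p-2}\nabla u\cdot\nabla\psi\,dx+\int_{\mathbb R^N}\int_{\mathbb R^N}\frac{|u(x)-u(y)|^{p-2}(u(x)-u(y))(\psi(x)-\psi(y))}{|x-y|^{N+ps}}\,dx\,dy .$$ **Weak comparison principle.** Suppose that $u,v\in X_0^{s,p}(\Omega)$ satisfy $$H_{s,p}(u,\psi)+\int_\Omega V|u|^{p-2}u\,\psi\,dx\ \le\ H_{s,p}(v,\psi)+\int_\Omega V|v|^{p-2}v\,\psi\,dx$$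 for all $\psi\in X_0^{s,p}(\Omega)$ with $\psi\ge 0$ a.e. in $\mathbb R^N$, and that $u\le v$ a.e. in $\mathbb R^N\setminus\Omega$. Then $u\le v$ a.e. in $\mathbb R^N$. -/

import Mathlib

open MeasureTheory Set

open scoped ENNReal NNReal ContDiff

noncomputable section

namespace MixedLaplacian

/-- `Ω` has Lipschitz boundary: near each boundary point, and with respect to a suitable
direction `e`, the set is the strict epigraph of a Lipschitz function of the component
orthogonal to `e`. -/
def HasLipschitzBoundary {N : ℕ} (Ω : Set (EuclideanSpace ℝ (Fin N))) : Prop :=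
  ∀ x₀ ∈ frontier Ω, ∃ r : ℝ, 0 < r ∧
    ∃ e : EuclideanSpace ℝ (Fin N), ‖e‖ = 1 ∧
    ∃ γ : EuclideanSpace ℝ (Fin N) → ℝ, (∃ K : ℝ≥0, LipschitzWith K γ) ∧
    ∀ x ∈ Metric.ball x₀ r, (x ∈ Ω ↔ γ (x - (inner ℝ e x) • e) < inner ℝ e x)

/-- `φ ∈ C_c^∞(U)`. -/
def IsTest {N : ℕ} (U : Set (EuclideanSpace ℝ (Fin N)))
    (φ : EuclideanSpace ℝ (Fin N) → ℝ) : Prop :=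
  ContDiff ℝ ∞ φ ∧ HasCompactSupport φ ∧ tsupport φ ⊆ U

/-- `G` is a weak (distributional) gradient of `u` on the open set `U`. -/
def IsWeakGradient {N : ℕ} (U : Set (EuclideanSpace ℝ (Fin N)))
    (u : EuclideanSpace ℝ (Fin N) → ℝ)
    (G : EuclideanSpace ℝ (Fin N) → EuclideanSpace ℝ (Fin N)) : Prop :=
  LocallyIntegrableOn u U volume ∧ LocallyIntegrableOn G U volume ∧
    ∀ φ : EuclideanSpace ℝ (Fin N) → ℝ, IsTest U φ → ∀ i : Fin N,
      ∫ x in U, u x * fderiv ℝ φ x (EuclideanSpace.single i 1) = -∫ x in U, G x i * φ x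

open Classical in
/-- The weak gradient `∇u` on `U` (unique up to null sets; `0` if there is none). -/
def weakGradient {N : ℕ} (U : Set (EuclideanSpace ℝ (Fin N)))
    (u : EuclideanSpace ℝ (Fin N) → ℝ) :
    EuclideanSpace ℝ (Fin N) → EuclideanSpace ℝ (Fin N) :=
  if h : ∃ G, IsWeakGradient U u G then h.choose else 0

/-- The Sobolev space `W^{1,p}(U)` (as functions; values outside `U` are irrelevant). -/
def W1p {N : ℕ} (p : ℝ) (U : Set (EuclideanSpace ℝ (Fin N))) :
    Set (EuclideanSpace ℝ (Fin N) → ℝ) :=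
  {u | MemLp u (ENNReal.ofReal p) (volume.restrict U) ∧
    ∃ G, IsWeakGradient U u G ∧ MemLp G (ENNReal.ofReal p) (volume.restrict U)}

/-- The Sobolev norm `(‖u‖_{L^p(U)}^p + ‖∇u‖_{L^p(U)}^p)^{1/p}`. -/
def sobolevNorm {N : ℕ} (p : ℝ) (U : Set (EuclideanSpace ℝ (Fin N)))
    (u : EuclideanSpace ℝ (Fin N) → ℝ) : ℝ≥0∞ :=
  (eLpNorm u (ENNReal.ofReal p) (volume.restrict U) ^ p +
    eLpNorm (weakGradient U u) (ENNReal.ofReal p) (volume.restrict U) ^ p) ^ (1 / p)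

/-- `W_0^{1,p}(U)`: the closure of `C_c^∞(U)` in `W^{1,p}(U)`. -/
def W1p0 {N : ℕ} (p : ℝ) (U : Set (EuclideanSpace ℝ (Fin N))) :
    Set (EuclideanSpace ℝ (Fin N) → ℝ) :=
  {u | u ∈ W1p p U ∧
    ∀ ε : ℝ≥0∞, 0 < ε → ∃ φ : EuclideanSpace ℝ (Fin N) → ℝ,
      IsTest U φ ∧ sobolevNorm p U (u - φ) < ε}

/-- The solution space `X_0^{s,p}(Ω)`: functions in `W^{1,p}(ℝ^N)` whose restriction to `Ω` is in
`W_0^{1,p}(Ω)` and which vanish a.e. outside `Ω`. As a set it does not involve `s`, which enters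
only through its norm. -/
def X0 {N : ℕ} (p : ℝ) (Ω : Set (EuclideanSpace ℝ (Fin N))) :
    Set (EuclideanSpace ℝ (Fin N) → ℝ) :=
  {u | u ∈ W1p p univ ∧ u ∈ W1p0 p Ω ∧ ∀ᵐ x ∂volume.restrict Ωᶜ, u x = 0}

/-- The form `H_{s,p}(u, ψ)` of the mixed local and nonlocal operator. -/
def H {N : ℕ} (s p : ℝ) (Ω : Set (EuclideanSpace ℝ (Fin N)))
    (u ψ : EuclideanSpace ℝ (Fin N) → ℝ) : ℝ :=
  (∫ x in Ω, ‖weakGradient Ω u x‖ ^ (p - 2) *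
      inner ℝ (weakGradient Ω u x) (weakGradient Ω ψ x)) +
  ∫ z : EuclideanSpace ℝ (Fin N) × EuclideanSpace ℝ (Fin N),
    |u z.1 - u z.2| ^ (p - 2) * (u z.1 - u z.2) * (ψ z.1 - ψ z.2) /
      ‖z.1 - z.2‖ ^ ((N : ℝ) + p * s)

end MixedLaplacian

end

noncomputable section

namespace MixedLaplacian

open Filter Topology

variable {N : ℕ} {p : ℝ} {Ω : Set (EuclideanSpace ℝ (Fin N))}
  {u v : EuclideanSpace ℝ (Fin N) → ℝ}
  {G F : EuclideanSpace ℝ (Fin N) → EuclideanSpace ℝ (Fin N)}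

/-! The inequality is tested with `ψ = (u - v)⁺`. Moving everything to one side leaves a local, a
nonlocal and a potential integral whose sum is at most zero. Each integrand is nonnegative: `a ↦
|a|^(p-2) a` is monotone, `t ↦ t⁺` is nondecreasing, and `V ≥ 0`. Hence the local integral vanishes.
Strict monotonicity (`inner_rpow_smul_sub_pos`) then gives `∇u = ∇v` a.e. on `{u > v} ∩ Ω`, so `∇ψ =
0`, and the Sobolev inequality forces `ψ = 0`.

Two points need work. The first is that `ψ` is admissible with gradient `1_{u>v} (∇u - ∇v)`. For
this, membership in `X0` is traded for `IsTestLimit`, which carries the gradient as data and is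
stable under differences and positive parts (`isTestLimit_of_mem_X0`, `IsTestLimit.posPart`,
`IsTestLimit.mem_X0`).

The second is that all integrals converge, without which they could not be subtracted termwise. The
Gagliardo energy is bounded through translation estimates (`IsTestLimit.integrable_gagliardo`), the
potential term through Hölder and Sobolev (`integrable_potential`). -/

/-- The Euclidean space `ℝ^N`. -/
abbrev Euc (N : ℕ) := EuclideanSpace ℝ (Fin N)

/-! ### Test functions and their gradients. -/

theorem IsTest.continuous {U : Set (Euc N)} {φ : Euc N → ℝ} (h : IsTest U φ) : Continuous φ :=
  h.1.continuous

theorem IsTest.differentiable {U : Set (Euc N)} {φ : Euc N → ℝ} (h : IsTest U φ) :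
    Differentiable ℝ φ := h.1.differentiable (by simp)

theorem IsTest.continuous_fderiv {U : Set (Euc N)} {φ : Euc N → ℝ} (h : IsTest U φ) :
    Continuous (fderiv ℝ φ) := h.1.continuous_fderiv (by simp)

theorem IsTest.continuous_gradient {U : Set (Euc N)} {φ : Euc N → ℝ} (h : IsTest U φ) :
    Continuous (gradient φ) :=
  (InnerProductSpace.toDual ℝ (Euc N)).symm.continuous.comp h.continuous_fderiv

theorem gradient_apply (φ : Euc N → ℝ) (x : Euc N) (i : Fin N) :
    gradient φ x i = fderiv ℝ φ x (EuclideanSpace.single i 1) := by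
  have h := EuclideanSpace.inner_single_right (𝕜 := ℝ) i (1 : ℝ) (gradient φ x)
  rw [inner_gradient_left] at h
  simpa using h.symm

theorem norm_gradient (φ : Euc N → ℝ) (x : Euc N) : ‖gradient φ x‖ = ‖fderiv ℝ φ x‖ := by
  simp [gradient]

theorem tsupport_gradient_subset (φ : Euc N → ℝ) : tsupport (gradient φ) ⊆ tsupport φ := by
  refine (closure_mono fun x hx => ?_).trans (tsupport_fderiv_subset ℝ (f := φ))
  simp only [Function.mem_support, gradient] at hx ⊢
  exact fun h => hx (by simp [h])

theorem IsTest.hasCompactSupport_gradient {U : Set (Euc N)} {φ : Euc N → ℝ} (h : IsTest U φ) :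
    HasCompactSupport (gradient φ) :=
  h.2.1.of_isClosed_subset (isClosed_tsupport _) (tsupport_gradient_subset φ)

theorem IsTest.memLp {U : Set (Euc N)} {φ : Euc N → ℝ} (h : IsTest U φ) (P : ℝ≥0∞) :
    MemLp φ P volume := h.continuous.memLp_of_hasCompactSupport h.2.1

theorem IsTest.memLp_gradient {U : Set (Euc N)} {φ : Euc N → ℝ} (h : IsTest U φ) (P : ℝ≥0∞) :
    MemLp (gradient φ) P volume :=
  h.continuous_gradient.memLp_of_hasCompactSupport h.hasCompactSupport_gradient

theorem IsTest.eq_zero {U : Set (Euc N)} {φ : Euc N → ℝ} (h : IsTest U φ) {x : Euc N}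
    (hx : x ∉ U) : φ x = 0 :=
  image_eq_zero_of_notMem_tsupport fun hx' => hx (h.2.2 hx')

theorem IsTest.gradient_eq_zero {U : Set (Euc N)} {φ : Euc N → ℝ} (h : IsTest U φ) {x : Euc N}
    (hx : x ∉ U) : gradient φ x = 0 :=
  image_eq_zero_of_notMem_tsupport fun hx' => hx (h.2.2 (tsupport_gradient_subset φ hx'))

theorem IsTest.sub {U : Set (Euc N)} {φ ψ : Euc N → ℝ} (h : IsTest U φ) (h' : IsTest U ψ) :
    IsTest U (φ - ψ) :=
  ⟨h.1.sub h'.1, h.2.1.sub h'.2.1,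
    (tsupport_sub φ ψ).trans (union_subset h.2.2 h'.2.2)⟩

theorem IsTest.gradient_sub {U : Set (Euc N)} {φ ψ : Euc N → ℝ} (h : IsTest U φ)
    (h' : IsTest U ψ) : gradient (φ - ψ) = gradient φ - gradient ψ := by
  ext1 x
  simp only [gradient, Pi.sub_apply]
  rw [fderiv_sub (h.differentiable x) (h'.differentiable x), map_sub]

/-! ### Limits of test functions. -/

/-- `u` and `G` are simultaneous limits in `L^p(ℝ^N)` of test functions supported in `Ω` and of
their gradients. -/
def IsTestLimit (p : ℝ) (Ω : Set (Euc N)) (u : Euc N → ℝ) (G : Euc N → Euc N) : Prop :=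
  MemLp u (ENNReal.ofReal p) volume ∧ MemLp G (ENNReal.ofReal p) volume ∧
    ∀ ε : ℝ≥0∞, 0 < ε → ∃ φ, IsTest Ω φ ∧ eLpNorm (u - φ) (ENNReal.ofReal p) volume ≤ ε ∧
      eLpNorm (G - gradient φ) (ENNReal.ofReal p) volume ≤ ε


theorem IsTest.isTestLimit {φ : Euc N → ℝ} (h : IsTest Ω φ) (p : ℝ) :
    IsTestLimit p Ω φ (gradient φ) :=
  ⟨h.memLp _, h.memLp_gradient _, fun ε _ => ⟨φ, h, by simp, by simp⟩⟩

theorem one_le_ofReal (hp : 1 < p) : 1 ≤ ENNReal.ofReal p := by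
  simpa using hp.le

theorem IsTestLimit.of_approx (hp : 1 < p) (hu : MemLp u (ENNReal.ofReal p) volume)
    (hG : MemLp G (ENNReal.ofReal p) volume)
    (h : ∀ ε : ℝ≥0∞, 0 < ε → ∃ v F, IsTestLimit p Ω v F ∧
      eLpNorm (u - v) (ENNReal.ofReal p) volume ≤ ε ∧
      eLpNorm (G - F) (ENNReal.ofReal p) volume ≤ ε) : IsTestLimit p Ω u G := by
  refine ⟨hu, hG, fun ε hε => ?_⟩
  obtain ⟨v, F, hv, h1, h2⟩ := h (ε / 2) (ENNReal.half_pos hε.ne')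
  obtain ⟨φ, hφ, h3, h4⟩ := hv.2.2 (ε / 2) (ENNReal.half_pos hε.ne')
  refine ⟨φ, hφ, ?_, ?_⟩
  · rw [← sub_add_sub_cancel u v φ, ← ENNReal.add_halves ε]
    exact (eLpNorm_add_le (hu.sub hv.1).1 (hv.1.sub (hφ.memLp _)).1 (one_le_ofReal hp)).trans
      (add_le_add h1 h3)
  · rw [← sub_add_sub_cancel G F (gradient φ), ← ENNReal.add_halves ε]
    exact (eLpNorm_add_le (hG.sub hv.2.1).1 (hv.2.1.sub (hφ.memLp_gradient _)).1
      (one_le_ofReal hp)).trans (add_le_add h2 h4)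

theorem IsTestLimit.of_tendsto (hp : 1 < p) (hu : MemLp u (ENNReal.ofReal p) volume)
    (hG : MemLp G (ENNReal.ofReal p) volume) {f : ℕ → Euc N → ℝ} {g : ℕ → Euc N → Euc N}
    (h : ∀ n, IsTestLimit p Ω (f n) (g n))
    (hf : Tendsto (fun n => eLpNorm (u - f n) (ENNReal.ofReal p) volume) atTop (𝓝 0))
    (hg : Tendsto (fun n => eLpNorm (G - g n) (ENNReal.ofReal p) volume) atTop (𝓝 0)) :
    IsTestLimit p Ω u G := by
  refine .of_approx hp hu hG fun ε hε => ?_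
  obtain ⟨n, h1, h2⟩ := ((ENNReal.tendsto_nhds_zero.1 hf ε hε).and
    (ENNReal.tendsto_nhds_zero.1 hg ε hε)).exists
  exact ⟨_, _, h n, h1, h2⟩

theorem IsTestLimit.sub (hp : 1 < p) (hu : IsTestLimit p Ω u G) (hv : IsTestLimit p Ω v F) :
    IsTestLimit p Ω (u - v) (G - F) := by
  refine ⟨hu.1.sub hv.1, hu.2.1.sub hv.2.1, fun ε hε => ?_⟩
  obtain ⟨φ, hφ, h1, h2⟩ := hu.2.2 (ε / 2) (ENNReal.half_pos hε.ne')
  obtain ⟨ψ, hψ, h3, h4⟩ := hv.2.2 (ε / 2) (ENNReal.half_pos hε.ne')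
  refine ⟨φ - ψ, hφ.sub hψ, ?_, ?_⟩
  · rw [sub_sub_sub_comm, ← ENNReal.add_halves ε]
    exact (eLpNorm_sub_le (hu.1.sub (hφ.memLp _)).1 (hv.1.sub (hψ.memLp _)).1
      (one_le_ofReal hp)).trans (add_le_add h1 h3)
  · rw [hφ.gradient_sub hψ, sub_sub_sub_comm, ← ENNReal.add_halves ε]
    exact (eLpNorm_sub_le (hu.2.1.sub (hφ.memLp_gradient _)).1
      (hv.2.1.sub (hψ.memLp_gradient _)).1 (one_le_ofReal hp)).trans (add_le_add h2 h4)

theorem IsTestLimit.congr (hu : IsTestLimit p Ω u G) (huv : u =ᵐ[volume] v)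
    (hGF : G =ᵐ[volume] F) : IsTestLimit p Ω v F := by
  refine ⟨hu.1.ae_eq huv, hu.2.1.ae_eq hGF, fun ε hε => ?_⟩
  obtain ⟨φ, hφ, h1, h2⟩ := hu.2.2 ε hε
  refine ⟨φ, hφ, ?_, ?_⟩
  · rwa [← eLpNorm_congr_ae (huv.sub (EventuallyEq.refl _ φ))]
  · rwa [← eLpNorm_congr_ae (hGF.sub (EventuallyEq.refl _ (gradient φ)))]

/-- Convergence in `L^p` implies convergence in measure, hence a.e. along a subsequence. The
pointwise limit feeds dominated convergence and Fatou later. -/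
theorem IsTestLimit.exists_seq (hp : 1 < p) (hu : IsTestLimit p Ω u G) :
    ∃ φ : ℕ → Euc N → ℝ, (∀ n, IsTest Ω (φ n)) ∧
      Tendsto (fun n => eLpNorm (u - φ n) (ENNReal.ofReal p) volume) atTop (𝓝 0) ∧
      Tendsto (fun n => eLpNorm (G - gradient (φ n)) (ENNReal.ofReal p) volume) atTop (𝓝 0) ∧
      ∀ᵐ x, Tendsto (fun n => φ n x) atTop (𝓝 (u x)) := by
  -- At `n = 0` the inverse is `⊤`, which is still a legitimate tolerance.
  have h0 : ∀ n : ℕ, (0 : ℝ≥0∞) < (n : ℝ≥0∞)⁻¹ := fun n => by simp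
  choose φ hφ h1 h2 using fun n : ℕ => hu.2.2 _ (h0 n)
  have t1 := tendsto_of_tendsto_of_tendsto_of_le_of_le tendsto_const_nhds
    ENNReal.tendsto_inv_nat_nhds_zero (fun n => zero_le) h1
  have t2 := tendsto_of_tendsto_of_tendsto_of_le_of_le tendsto_const_nhds
    ENNReal.tendsto_inv_nat_nhds_zero (fun n => zero_le) h2
  have t3 : TendstoInMeasure volume φ atTop u := by
    refine tendstoInMeasure_of_tendsto_eLpNorm
      (one_pos.trans_le (one_le_ofReal hp)).ne' (fun n => ((hφ n).memLp 1).1) hu.1.1 ?_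
    simpa only [eLpNorm_sub_comm] using t1
  obtain ⟨ns, hns, h⟩ := t3.exists_seq_tendsto_ae
  exact ⟨fun n => φ (ns n), fun n => hφ _, t1.comp hns.tendsto_atTop, t2.comp hns.tendsto_atTop, h⟩

theorem IsTestLimit.ae_eq_zero (hp : 1 < p) (hu : IsTestLimit p Ω u G) :
    ∀ᵐ x, x ∉ Ω → u x = 0 := by
  obtain ⟨φ, hφ, -, -, h⟩ := hu.exists_seq hp
  filter_upwards [h] with x hx hxΩ
  refine tendsto_nhds_unique hx ?_
  simp [(hφ _).eq_zero hxΩ]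

theorem IsTestLimit.gradient_ae_eq_zero (hΩ : MeasurableSet Ω) (hp : 1 < p)
    (hu : IsTestLimit p Ω u G) : ∀ᵐ x, x ∉ Ω → G x = 0 := by
  have : eLpNorm G (ENNReal.ofReal p) (volume.restrict Ωᶜ) = 0 := by
    refine le_antisymm (le_of_forall_pos_le_add fun ε hε => ?_) zero_le
    obtain ⟨φ, hφ, -, h2⟩ := hu.2.2 ε hε
    rw [zero_add]
    refine le_trans ?_ h2
    refine le_trans (le_of_eq ?_)
      (eLpNorm_mono_measure _ (Measure.restrict_le_self (s := Ωᶜ)))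
    refine eLpNorm_congr_ae ?_
    filter_upwards [ae_restrict_mem hΩ.compl] with x hx
    simp [hφ.gradient_eq_zero hx]
  rw [eLpNorm_eq_zero_iff hu.2.1.1.restrict (one_pos.trans_le (one_le_ofReal hp)).ne'] at this
  exact (ae_restrict_iff' hΩ.compl).1 this

/-! ### Weak gradients, and the identification of `X0` with limits of test functions. -/

theorem integrable_mul_of_tsupport_subset {U : Set (Euc N)} {f g : Euc N → ℝ}
    (hf : LocallyIntegrableOn f U volume) (hg : Continuous g) (hgc : HasCompactSupport g)
    (hgU : tsupport g ⊆ U) : Integrable (fun x => f x * g x) volume := by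
  have h1 : IntegrableOn f (tsupport g) volume := hf.integrableOn_compact_subset hgU hgc
  have h2 := h1.mul_continuousOn hg.continuousOn hgc
  refine (integrableOn_iff_integrable_of_support_subset fun x hx => ?_).1 h2
  exact subset_tsupport g (right_ne_zero_of_mul hx)

theorem locallyIntegrableOn_apply {U : Set (Euc N)}
    (hG : LocallyIntegrableOn G U volume) (i : Fin N) :
    LocallyIntegrableOn (fun x => G x i) U volume := by
  intro x hx
  obtain ⟨s, hs, h⟩ := hG x hx
  exact ⟨s, hs, (EuclideanSpace.proj (𝕜 := ℝ) i).integrable_comp h⟩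

theorem IsTest.fderiv_apply {U : Set (Euc N)} {φ : Euc N → ℝ} (h : IsTest U φ) (i : Fin N) :
    Continuous (fun x => fderiv ℝ φ x (EuclideanSpace.single i 1)) ∧
    HasCompactSupport (fun x => fderiv ℝ φ x (EuclideanSpace.single i 1)) ∧
    tsupport (fun x => fderiv ℝ φ x (EuclideanSpace.single i 1)) ⊆ U := by
  have hs : tsupport (fun x => fderiv ℝ φ x (EuclideanSpace.single i 1)) ⊆ tsupport φ := by
    refine (closure_mono fun x hx => ?_).trans (tsupport_fderiv_subset ℝ (f := φ))
    simp only [Function.mem_support] at hx ⊢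
    exact fun h => hx (by simp [h])
  exact ⟨h.continuous_fderiv.clm_apply continuous_const,
    h.2.1.of_isClosed_subset (isClosed_tsupport _) hs, hs.trans h.2.2⟩

theorem IsWeakGradient.sub {U : Set (Euc N)} (hu : IsWeakGradient U u G)
    (hv : IsWeakGradient U v F) : IsWeakGradient U (u - v) (G - F) := by
  refine ⟨hu.1.sub hv.1, hu.2.1.sub hv.2.1, fun φ hφ i => ?_⟩
  have h1 := hu.2.2 φ hφ i
  have h2 := hv.2.2 φ hφ i
  obtain ⟨c1, c2, c3⟩ := hφ.fderiv_apply i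
  simp only [Pi.sub_apply, PiLp.sub_apply, sub_mul]
  rw [integral_sub (integrable_mul_of_tsupport_subset hu.1 c1 c2 c3).integrableOn
    (integrable_mul_of_tsupport_subset hv.1 c1 c2 c3).integrableOn,
    integral_sub
    (integrable_mul_of_tsupport_subset (locallyIntegrableOn_apply hu.2.1 i)
      hφ.continuous hφ.2.1 hφ.2.2).integrableOn
    (integrable_mul_of_tsupport_subset (locallyIntegrableOn_apply hv.2.1 i)
      hφ.continuous hφ.2.1 hφ.2.2).integrableOn, h1, h2]
  ring

/-- The difference of two weak gradients of `u` is a weak gradient of zero; the fundamental lemma of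
the calculus of variations applies to each coordinate. -/
theorem IsWeakGradient.ae_eq {U : Set (Euc N)} (hU : IsOpen U) (hG : IsWeakGradient U u G)
    (hF : IsWeakGradient U u F) : ∀ᵐ x, x ∈ U → G x = F x := by
  have h0 : IsWeakGradient U (u - u) (G - F) := hG.sub hF
  have : ∀ i : Fin N, ∀ᵐ x, x ∈ U → (G - F) x i = 0 := fun i => by
    refine hU.ae_eq_zero_of_integral_contDiff_smul_eq_zero (locallyIntegrableOn_apply h0.2.1 i)
      fun g h1 h2 h3 => ?_
    have := h0.2.2 g ⟨h1, h2, h3⟩ i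
    simp only [sub_self, Pi.zero_apply, zero_mul, integral_zero, zero_eq_neg] at this
    rw [← this, setIntegral_eq_integral_of_forall_compl_eq_zero]
    · simp only [smul_eq_mul, mul_comm]
    · intro x hx
      rw [(show IsTest U g from ⟨h1, h2, h3⟩).eq_zero hx, mul_zero]
  filter_upwards [ae_all_iff.2 this] with x hx hxU
  ext i
  simpa [sub_eq_zero] using hx i hxU

theorem weakGradient_spec {U : Set (Euc N)} (h : ∃ G, IsWeakGradient U u G) :
    IsWeakGradient U u (weakGradient U u) := by
  rw [weakGradient, dif_pos h]
  exact h.choose_spec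

theorem tendsto_integral_mul_of_tendsto_eLpNorm {X : Type*} [MeasurableSpace X] {μ : Measure X}
    {P Q : ℝ≥0∞} [ENNReal.HolderConjugate P Q] {f : X → ℝ} {fn : ℕ → X → ℝ} {g : X → ℝ}
    (hf : MemLp f P μ)
    (hfn : ∀ n, MemLp (fn n) P μ) (hg : MemLp g Q μ)
    (h : Tendsto (fun n => eLpNorm (f - fn n) P μ) atTop (𝓝 0)) :
    Tendsto (fun n => ∫ x, fn n x * g x ∂μ) atTop (𝓝 (∫ x, f x * g x ∂μ)) := by
  have hI : ∀ {k : X → ℝ}, MemLp k P μ → Integrable (fun x => k x * g x) μ := fun hk =>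
    memLp_one_iff_integrable.1 (hg.mul' hk)
  refine tendsto_integral_of_L1' _ (hI hf).1 (Eventually.of_forall fun n => hI (hfn n)) ?_
  have h' : Tendsto (fun n => eLpNorm (f - fn n) P μ * eLpNorm g Q μ) atTop (𝓝 0) := by
    simpa using ENNReal.Tendsto.mul_const h (Or.inr hg.2.ne)
  refine tendsto_of_tendsto_of_tendsto_of_le_of_le tendsto_const_nhds h' (fun n => zero_le)
    fun n => ?_
  have := eLpNorm_smul_le_mul_eLpNorm (p := P) (q := Q) (r := 1) hg.1 (hf.sub (hfn n)).1
  refine le_trans (le_of_eq ?_) this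
  rw [eLpNorm_sub_comm]
  congr 1
  ext x
  simp [sub_mul]

/-- Integration by parts holds for the approximants on all of `ℝ^N`, and Hölder lets it pass to the
limit. The set `U` is arbitrary because the test function and its derivatives vanish off `U`. -/
theorem IsTestLimit.isWeakGradient (hp : 1 < p) (hu : IsTestLimit p Ω u G) (U : Set (Euc N)) :
    IsWeakGradient U u G := by
  have hP := one_le_ofReal hp
  refine ⟨(hu.1.locallyIntegrable hP).locallyIntegrableOn _,
    (hu.2.1.locallyIntegrable hP).locallyIntegrableOn _, fun ψ hψ i => ?_⟩
  obtain ⟨c1, c2, c3⟩ := hψ.fderiv_apply i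
  rw [setIntegral_eq_integral_of_forall_compl_eq_zero,
    setIntegral_eq_integral_of_forall_compl_eq_zero]
  rotate_left
  · intro x hx
    rw [hψ.eq_zero hx, mul_zero]
  · intro x hx
    have : fderiv ℝ ψ x (EuclideanSpace.single i 1) = 0 :=
      image_eq_zero_of_notMem_tsupport (f := fun x => fderiv ℝ ψ x (EuclideanSpace.single i 1))
        fun h => hx (c3 h)
    rw [this, mul_zero]
  obtain ⟨φ, hφ, h1, h2, -⟩ := hu.exists_seq hp
  have : ENNReal.HolderConjugate (ENNReal.ofReal p) (ENNReal.ofReal p.conjExponent) :=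
    (Real.HolderConjugate.conjExponent hp).ennrealOfReal
  have t1 := tendsto_integral_mul_of_tendsto_eLpNorm (Q := ENNReal.ofReal p.conjExponent)
    hu.1 (fun n => (hφ n).memLp _) (c1.memLp_of_hasCompactSupport c2) h1
  have t2 := tendsto_integral_mul_of_tendsto_eLpNorm (P := ENNReal.ofReal p) (μ := volume)
    (Q := ENNReal.ofReal p.conjExponent) (f := fun x => G x i)
    (fn := fun n x => gradient (φ n) x i)
    (hu.2.1.continuousLinearMap_comp (EuclideanSpace.proj (𝕜 := ℝ) i))
    (fun n => ((hφ n).memLp_gradient _).continuousLinearMap_comp (EuclideanSpace.proj (𝕜 := ℝ) i))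
    (hψ.memLp _) (by
      refine tendsto_of_tendsto_of_tendsto_of_le_of_le tendsto_const_nhds h2 (fun n => zero_le)
        fun n => eLpNorm_mono fun x => ?_
      exact PiLp.norm_apply_le ((G - gradient (φ n)) x) i)
  refine tendsto_nhds_unique t1 (t2.neg.congr fun n => ?_)
  rw [integral_mul_fderiv_eq_neg_fderiv_mul_of_integrable]
  · simp only [gradient_apply]
  · obtain ⟨d1, d2, d3⟩ := (hφ n).fderiv_apply i
    exact (d1.mul hψ.continuous).integrable_of_hasCompactSupport d2.mul_right
  · exact ((hφ n).continuous.mul c1).integrable_of_hasCompactSupport c2.mul_left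
  · exact ((hφ n).continuous.mul hψ.continuous).integrable_of_hasCompactSupport hψ.2.1.mul_left
  · exact fun x _ => (hφ n).differentiable x
  · exact fun x _ => hψ.differentiable x

theorem IsTestLimit.weakGradient_ae_eq (hp : 1 < p) (hu : IsTestLimit p Ω u G) {U : Set (Euc N)}
    (hU : IsOpen U) : ∀ᵐ x, x ∈ U → weakGradient U u x = G x :=
  (weakGradient_spec ⟨G, hu.isWeakGradient hp U⟩).ae_eq hU (hu.isWeakGradient hp U)

theorem IsTestLimit.mem_X0 (hp : 1 < p) (hΩ : IsOpen Ω) (hu : IsTestLimit p Ω u G) :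
    u ∈ X0 p Ω := by
  refine ⟨⟨hu.1.restrict _, G, hu.isWeakGradient hp _, hu.2.1.restrict _⟩,
    ⟨⟨hu.1.restrict _, G, hu.isWeakGradient hp _, hu.2.1.restrict _⟩, fun ε hε => ?_⟩,
    (ae_restrict_iff' hΩ.measurableSet.compl).2 (hu.ae_eq_zero hp)⟩
  obtain ⟨φ, hφ, h1, h2, -⟩ := hu.exists_seq hp
  have hp0 : 0 < p := by linarith
  have t : Tendsto (fun n => (eLpNorm (u - φ n) (ENNReal.ofReal p) volume ^ p +
      eLpNorm (G - gradient (φ n)) (ENNReal.ofReal p) volume ^ p) ^ (1 / p)) atTop (𝓝 0) := by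
    have := ((h1.ennrpow_const p).add (h2.ennrpow_const p)).ennrpow_const (1 / p)
    simpa [hp0, ENNReal.zero_rpow_of_pos] using this
  obtain ⟨n, hn⟩ := (t.eventually_lt_const hε).exists
  refine ⟨φ n, hφ n, lt_of_le_of_lt ?_ hn⟩
  unfold sobolevNorm
  have hw : eLpNorm (weakGradient Ω (u - φ n)) (ENNReal.ofReal p) (volume.restrict Ω) =
      eLpNorm (G - gradient (φ n)) (ENNReal.ofReal p) (volume.restrict Ω) :=
    eLpNorm_congr_ae ((ae_restrict_iff' hΩ.measurableSet).2
      ((hu.sub hp ((hφ n).isTestLimit p)).weakGradient_ae_eq hp hΩ))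
  rw [hw]
  gcongr <;> exact Measure.restrict_le_self

/-- Both `u` and the approximants vanish off `Ω`, so approximation in `W^{1,p}(Ω)` is approximation
on `ℝ^N` after extending the gradient by zero. -/
theorem isTestLimit_of_mem_X0 (hp : 1 < p) (hΩ : IsOpen Ω) (hu : u ∈ X0 p Ω) :
    IsTestLimit p Ω u (Ω.indicator (weakGradient Ω u)) := by
  obtain ⟨hu1, ⟨hu2, hu3⟩, hu0⟩ := hu
  obtain ⟨-, G, hG, hGp⟩ := hu2
  have hp0 : 0 < p := by linarith
  have hw := weakGradient_spec ⟨G, hG⟩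
  have hwG := hw.ae_eq hΩ hG
  rw [← ae_restrict_iff' hΩ.measurableSet] at hwG
  have hu0' := (ae_restrict_iff' hΩ.measurableSet.compl).1 hu0
  refine ⟨by simpa using hu1.1, (memLp_indicator_iff_restrict hΩ.measurableSet).2
    (hGp.ae_eq (hwG.mono fun x hx => hx.symm)), fun ε hε => ?_⟩
  obtain ⟨φ, hφ, h⟩ := hu3 ε hε
  have h1 : eLpNorm (u - φ) (ENNReal.ofReal p) (volume.restrict Ω) ≤ ε := by
    refine le_trans ?_ h.le
    rw [sobolevNorm, one_div, ENNReal.le_rpow_inv_iff hp0]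
    exact le_self_add
  have h2 : eLpNorm (weakGradient Ω (u - φ)) (ENNReal.ofReal p) (volume.restrict Ω) ≤ ε := by
    refine le_trans ?_ h.le
    rw [sobolevNorm, one_div, ENNReal.le_rpow_inv_iff hp0]
    exact le_add_self
  refine ⟨φ, hφ, ?_, ?_⟩
  · rw [← eLpNorm_indicator_eq_eLpNorm_restrict hΩ.measurableSet] at h1
    refine le_trans (le_of_eq (eLpNorm_congr_ae ?_)) h1
    filter_upwards [hu0'] with x hx
    by_cases hxΩ : x ∈ Ω
    · simp [hxΩ]
    · simp [hxΩ, hx hxΩ, hφ.eq_zero hxΩ]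
  · rw [← eLpNorm_indicator_eq_eLpNorm_restrict hΩ.measurableSet] at h2
    refine le_trans (le_of_eq (eLpNorm_congr_ae ?_)) h2
    have hs := hw.sub ((hφ.isTestLimit p).isWeakGradient hp Ω)
    filter_upwards [(weakGradient_spec ⟨_, hs⟩).ae_eq hΩ hs] with x hx
    by_cases hxΩ : x ∈ Ω
    · simp [hxΩ, hx hxΩ]
    · simp [hxΩ, hφ.gradient_eq_zero hxΩ]

/-! ### Chain rule and positive part. -/

/-- Dominated convergence in `L^p`. -/
theorem tendsto_eLpNorm_zero_of_dominated {X E : Type*} [MeasurableSpace X] {μ : Measure X}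
    [NormedAddCommGroup E] (hp : 0 < p) {f : ℕ → X → E} {b : X → ℝ}
    (hf : ∀ n, AEStronglyMeasurable (f n) μ) (hb : MemLp b (ENNReal.ofReal p) μ)
    (hfb : ∀ n, ∀ᵐ x ∂μ, ‖f n x‖ ≤ b x) (h : ∀ᵐ x ∂μ, Tendsto (fun n => f n x) atTop (𝓝 0)) :
    Tendsto (fun n => eLpNorm (f n) (ENNReal.ofReal p) μ) atTop (𝓝 0) := by
  have h0 : ENNReal.ofReal p ≠ 0 := by simpa using hp
  simp only [eLpNorm_eq_lintegral_rpow_enorm_toReal h0 ENNReal.ofReal_ne_top,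
    ENNReal.toReal_ofReal hp.le]
  have h1 : Tendsto (fun n => ∫⁻ x, ‖f n x‖ₑ ^ p ∂μ) atTop (𝓝 (∫⁻ x, 0 ∂μ)) := by
    refine tendsto_lintegral_of_dominated_convergence' (fun x => ‖b x‖ₑ ^ p)
      (fun n => (hf n).enorm.pow_const p) (fun n => ?_) ?_ ?_
    · filter_upwards [hfb n] with x hx
      have : ‖f n x‖ₑ ≤ ‖b x‖ₑ := enorm_le_iff_norm_le.2 (hx.trans (le_abs_self _))
      gcongr
    · have := lintegral_rpow_enorm_lt_top_of_eLpNorm_lt_top h0 ENNReal.ofReal_ne_top hb.2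
      rw [ENNReal.toReal_ofReal hp.le] at this
      exact this.ne
    · filter_upwards [h] with x hx
      have := (hx.enorm).ennrpow_const p
      simpa [ENNReal.zero_rpow_of_pos hp] using this
  have h2 := h1.ennrpow_const (1 / p)
  simpa [ENNReal.zero_rpow_of_pos, hp] using h2

theorem IsTest.comp {φ : Euc N → ℝ} (h : IsTest Ω φ) {f : ℝ → ℝ} (hf : ContDiff ℝ ∞ f)
    (hf0 : f 0 = 0) : IsTest Ω (f ∘ φ) :=
  ⟨hf.comp h.1, h.2.1.comp_left hf0,
    (closure_mono (Function.support_comp_subset hf0 φ)).trans h.2.2⟩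

theorem IsTest.gradient_comp {φ : Euc N → ℝ} (h : IsTest Ω φ) {f : ℝ → ℝ}
    (hf : ContDiff ℝ ∞ f) (x : Euc N) :
    gradient (f ∘ φ) x = deriv f (φ x) • gradient φ x := by
  have h1 : HasDerivAt f (deriv f (φ x)) (φ x) :=
    (hf.differentiable (by simp) _).hasDerivAt
  have h2 := h1.comp_hasFDerivAt x (h.differentiable x).hasFDerivAt
  rw [gradient, h2.fderiv, gradient, map_smulₛₗ]
  simp

/-- The gradient error splits as `(f'(u) - f'(φₙ)) G + f'(φₙ) (G - ∇φₙ)`: the first term tends to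
zero by dominated convergence, the second because `f'` is bounded. -/
theorem IsTestLimit.comp (hp : 1 < p) (hu : IsTestLimit p Ω u G) {f : ℝ → ℝ}
    (hf : ContDiff ℝ ∞ f) (hf0 : f 0 = 0) {C : ℝ≥0} (hC : ∀ t, ‖deriv f t‖ ≤ C) :
    IsTestLimit p Ω (fun x => f (u x)) (fun x => deriv f (u x) • G x) := by
  have hp0 : 0 < p := by linarith
  have hlip : LipschitzWith C f :=
    lipschitzWith_of_nnnorm_deriv_le (hf.differentiable (by simp)) fun t => hC t
  have hd : Continuous (deriv f) := hf.continuous_deriv (by simp)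
  obtain ⟨φ, hφ, h1, h2, h3⟩ := hu.exists_seq hp
  have mG : AEStronglyMeasurable (fun x => deriv f (u x) • G x) volume :=
    (hd.comp_aestronglyMeasurable hu.1.1).smul hu.2.1.1
  refine .of_tendsto hp (f := fun n => f ∘ φ n) (g := fun n => gradient (f ∘ φ n)) ?_ ?_
    (fun n => ((hφ n).comp hf hf0).isTestLimit p) ?_ ?_
  · refine hu.1.of_le_mul (c := C) (hf.continuous.comp_aestronglyMeasurable hu.1.1)
      (ae_of_all _ fun x => ?_)
    simpa [hf0] using hlip.norm_sub_le (u x) 0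
  · refine hu.2.1.of_le_mul (c := C) mG (ae_of_all _ fun x => ?_)
    rw [norm_smul]
    gcongr
    exact hC _
  · have t : Tendsto (fun n => C * eLpNorm (u - φ n) (ENNReal.ofReal p) volume) atTop (𝓝 0) := by
      simpa using ENNReal.Tendsto.const_mul h1 (Or.inr ENNReal.coe_ne_top)
    refine tendsto_of_tendsto_of_tendsto_of_le_of_le tendsto_const_nhds t (fun n => zero_le)
      fun n => ?_
    refine eLpNorm_le_nnreal_smul_eLpNorm_of_ae_le_mul (ae_of_all _ fun x => ?_) _
    exact hlip.norm_sub_le (u x) (φ n x)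
  · have d1 : Tendsto (fun n => eLpNorm (fun x => (deriv f (u x) - deriv f (φ n x)) • G x)
        (ENNReal.ofReal p) volume) atTop (𝓝 0) := by
      refine tendsto_eLpNorm_zero_of_dominated hp0 (b := fun x => (2 * C) * ‖G x‖) (fun n => ?_)
        (hu.2.1.norm.const_mul _) (fun n => ae_of_all _ fun x => ?_) ?_
      · exact ((hd.comp_aestronglyMeasurable hu.1.1).sub
          (hd.comp_aestronglyMeasurable ((hφ n).memLp 1).1)).smul hu.2.1.1
      · rw [norm_smul, two_mul]
        gcongr
        exact (norm_sub_le _ _).trans (add_le_add (hC _) (hC _))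
      · filter_upwards [h3] with x hx
        have := ((tendsto_const_nhds (x := deriv f (u x))).sub
          ((hd.tendsto (u x)).comp hx)).smul_const (G x)
        simpa using this
    have d2 : Tendsto (fun n => C * eLpNorm (G - gradient (φ n)) (ENNReal.ofReal p) volume)
        atTop (𝓝 0) := by
      simpa using ENNReal.Tendsto.const_mul h2 (Or.inr ENNReal.coe_ne_top)
    have d3 := d1.add d2
    rw [add_zero] at d3
    refine tendsto_of_tendsto_of_tendsto_of_le_of_le tendsto_const_nhds d3 (fun n => zero_le)
      fun n => ?_
    have e : (fun x => deriv f (u x) • G x) - gradient (f ∘ φ n) =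
        (fun x => (deriv f (u x) - deriv f (φ n x)) • G x) +
          fun x => deriv f (φ n x) • (G - gradient (φ n)) x := by
      ext1 x
      simp only [Pi.sub_apply, Pi.add_apply, (hφ n).gradient_comp hf, sub_smul, smul_sub]
      abel
    have m2 : AEStronglyMeasurable (fun x => deriv f (φ n x) • (G - gradient (φ n)) x) volume :=
      (hd.comp_aestronglyMeasurable ((hφ n).memLp 1).1).smul
        (hu.2.1.1.sub ((hφ n).memLp_gradient 1).1)
    rw [e]
    refine (eLpNorm_add_le ?_ m2 (one_le_ofReal hp)).trans (add_le_add le_rfl ?_)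
    · exact ((hd.comp_aestronglyMeasurable hu.1.1).sub
          (hd.comp_aestronglyMeasurable ((hφ n).memLp 1).1)).smul hu.2.1.1
    · refine eLpNorm_le_nnreal_smul_eLpNorm_of_ae_le_mul (ae_of_all _ fun x => ?_) _
      rw [nnnorm_smul]
      gcongr
      exact hC _

/-- A smooth function which vanishes on `(-∞, 0]` and is the identity on `[1, ∞)`. -/
def smoothPos (t : ℝ) : ℝ := t * Real.smoothTransition t

theorem contDiff_smoothPos : ContDiff ℝ ∞ smoothPos :=
  contDiff_id.mul Real.smoothTransition.contDiff

theorem smoothPos_of_nonpos {t : ℝ} (h : t ≤ 0) : smoothPos t = 0 := by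
  simp [smoothPos, Real.smoothTransition.zero_of_nonpos h]

theorem smoothPos_of_one_le {t : ℝ} (h : 1 ≤ t) : smoothPos t = t := by
  simp [smoothPos, Real.smoothTransition.one_of_one_le h]

theorem deriv_smoothPos_of_nonpos {t : ℝ} (h : t ≤ 0) : deriv smoothPos t = 0 := by
  rcases h.lt_or_eq with h | rfl
  · have : smoothPos =ᶠ[𝓝 t] fun _ => 0 := by
      filter_upwards [Iio_mem_nhds h] with s hs using smoothPos_of_nonpos (le_of_lt hs)
    rw [this.deriv_eq, deriv_const]
  · have h1 : HasDerivAt smoothPos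
        (1 * Real.smoothTransition 0 + 0 * deriv Real.smoothTransition 0) 0 :=
      (hasDerivAt_id' (0 : ℝ)).mul
        ((Real.smoothTransition.contDiff (n := 1)).differentiable (by simp) 0).hasDerivAt
    simp [h1.deriv]

theorem deriv_smoothPos_of_one_lt {t : ℝ} (h : 1 < t) : deriv smoothPos t = 1 := by
  have : smoothPos =ᶠ[𝓝 t] fun s => s := by
    filter_upwards [Ioi_mem_nhds h] with s hs using smoothPos_of_one_le (le_of_lt hs)
  rw [this.deriv_eq, deriv_id'']

theorem exists_bound_deriv_smoothPos : ∃ C : ℝ≥0, ∀ t, ‖deriv smoothPos t‖ ≤ C := by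
  obtain ⟨C, hC⟩ := (isCompact_Icc (a := (0 : ℝ)) (b := 1)).exists_bound_of_continuousOn
    (contDiff_smoothPos.continuous_deriv (by simp)).continuousOn
  refine ⟨⟨max C 1, by positivity⟩, fun t => ?_⟩
  change _ ≤ max C 1
  rcases le_or_gt t 0 with h | h
  · rw [deriv_smoothPos_of_nonpos h]
    simp
  rcases le_or_gt t 1 with h' | h'
  · exact (hC t ⟨h.le, h'⟩).trans (le_max_left _ _)
  · rw [deriv_smoothPos_of_one_lt h']
    simp

/-- The rescalings `smoothPos ((n+1) t) / (n+1)` converge to `t⁺`, with derivatives uniformly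
bounded by `C`. These derivatives vanish at `t = 0` too, so they converge to `1_{t>0}` at every `t`,
and nothing need be known about `∇u` on `{u = 0}`. -/
theorem IsTestLimit.posPart (hp : 1 < p) (hu : IsTestLimit p Ω u G) :
    IsTestLimit p Ω (fun x => max (u x) 0)
      (fun x => (Ioi (0 : ℝ)).indicator (1 : ℝ → ℝ) (u x) • G x) := by
  have hp0 : 0 < p := by linarith
  obtain ⟨C, hC⟩ := exists_bound_deriv_smoothPos
  set f : ℕ → ℝ → ℝ := fun n t => ((n : ℝ) + 1)⁻¹ * smoothPos (((n : ℝ) + 1) * t) with hf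
  have hn0 : ∀ n : ℕ, (n : ℝ) + 1 ≠ 0 := fun n => by positivity
  have hfc : ∀ n, ContDiff ℝ ∞ (f n) := fun n =>
    contDiff_const.mul (contDiff_smoothPos.comp (contDiff_const.mul contDiff_id))
  have hf0 : ∀ n, f n 0 = 0 := fun n => by simp [hf, smoothPos]
  have hfd : ∀ n t, deriv (f n) t = deriv smoothPos (((n : ℝ) + 1) * t) := fun n t => by
    have h1 : HasDerivAt smoothPos (deriv smoothPos (((n : ℝ) + 1) * t)) (((n : ℝ) + 1) * t) :=
      (contDiff_smoothPos.differentiable (by simp) _).hasDerivAt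
    have h2 := (h1.comp t ((hasDerivAt_id t).const_mul ((n : ℝ) + 1))).const_mul ((n : ℝ) + 1)⁻¹
    refine h2.deriv.trans ?_
    field_simp [hn0 n]
  have hev : ∀ t : ℝ, 0 < t → ∀ᶠ n : ℕ in atTop, 1 < ((n : ℝ) + 1) * t := fun t ht =>
    ((tendsto_natCast_atTop_atTop.atTop_add tendsto_const_nhds).atTop_mul_const ht
      ).eventually_gt_atTop 1
  have hfb : ∀ n t, ‖max t 0 - f n t‖ ≤ ‖t‖ := fun n t => by
    have h1 : f n t = t * Real.smoothTransition (((n : ℝ) + 1) * t) := by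
      simp only [hf, smoothPos]
      field_simp [hn0 n]
    rw [h1]
    have h2 := Real.smoothTransition.nonneg (((n : ℝ) + 1) * t)
    have h3 := Real.smoothTransition.le_one (((n : ℝ) + 1) * t)
    rcases le_total t 0 with h | h
    · rw [Real.smoothTransition.zero_of_nonpos (mul_nonpos_of_nonneg_of_nonpos (by positivity) h),
        max_eq_right h]
      simp
    · rw [max_eq_left h, Real.norm_of_nonneg h, Real.norm_of_nonneg] <;> nlinarith
  have hft : ∀ t, Tendsto (fun n => max t 0 - f n t) atTop (𝓝 0) := fun t => by
    rcases le_or_gt t 0 with h | h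
    · refine tendsto_const_nhds.congr fun n => ?_
      simp only [hf]
      rw [smoothPos_of_nonpos (mul_nonpos_of_nonneg_of_nonpos (by positivity) h), max_eq_right h]
      simp
    · refine tendsto_const_nhds.congr' ?_
      filter_upwards [hev t h] with n hn
      simp only [hf]
      rw [smoothPos_of_one_le hn.le, max_eq_left h.le]
      field_simp [hn0 n]
      simp
  have hdt : ∀ t, Tendsto (fun n => (Ioi (0 : ℝ)).indicator (1 : ℝ → ℝ) t - deriv (f n) t) atTop (𝓝 0) :=
      fun t => by
    simp only [hfd]
    rcases le_or_gt t 0 with h | h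
    · refine tendsto_const_nhds.congr fun n => ?_
      rw [deriv_smoothPos_of_nonpos (mul_nonpos_of_nonneg_of_nonpos (by positivity) h)]
      simp [h]
    · refine tendsto_const_nhds.congr' ?_
      filter_upwards [hev t h] with n hn
      rw [deriv_smoothPos_of_one_lt hn]
      simp [h]
  have hi1 : ∀ t : ℝ, ‖(Ioi (0 : ℝ)).indicator (1 : ℝ → ℝ) t‖ ≤ 1 := fun t => by
    by_cases h : 0 < t <;> simp [h]
  have mI : AEStronglyMeasurable (fun x => (Ioi (0 : ℝ)).indicator (1 : ℝ → ℝ) (u x)) volume :=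
    ((measurable_one.indicator measurableSet_Ioi).comp_aemeasurable
      hu.1.1.aemeasurable).aestronglyMeasurable
  have mP : AEStronglyMeasurable (fun x => max (u x) 0) volume := hu.1.1.sup
    aestronglyMeasurable_const
  refine .of_tendsto hp ?_ ?_ (fun n => hu.comp hp (hfc n) (hf0 n) (C := C)
    (fun t => by rw [hfd]; exact hC _)) ?_ ?_
  · refine hu.1.mono mP (ae_of_all _ fun x => ?_)
    rw [Real.norm_of_nonneg (le_max_right _ _)]
    exact max_le (le_abs_self _) (norm_nonneg _)
  · refine hu.2.1.mono (mI.smul hu.2.1.1) (ae_of_all _ fun x => ?_)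
    rw [norm_smul]
    exact mul_le_of_le_one_left (norm_nonneg _) (hi1 _)
  · refine tendsto_eLpNorm_zero_of_dominated hp0 (fun n => ?_) hu.1.norm
      (fun n => ae_of_all _ fun x => hfb n (u x)) (ae_of_all _ fun x => hft (u x))
    exact mP.sub ((hfc n).continuous.comp_aestronglyMeasurable hu.1.1)
  · refine tendsto_eLpNorm_zero_of_dominated hp0 (b := fun x => (1 + C) * ‖G x‖) (fun n => ?_)
      (hu.2.1.norm.const_mul _) (fun n => ae_of_all _ fun x => ?_) (ae_of_all _ fun x => ?_)
    · exact (mI.smul hu.2.1.1).sub ((((hfc n).continuous_deriv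
        (by simp)).comp_aestronglyMeasurable hu.1.1).smul hu.2.1.1)
    · simp only [Pi.sub_apply, ← sub_smul]
      rw [norm_smul]
      gcongr
      refine (norm_sub_le _ _).trans (add_le_add (hi1 _) ?_)
      rw [hfd]
      exact hC _
    · simpa only [Pi.sub_apply, ← sub_smul, zero_smul] using (hdt (u x)).smul_const (G x)

/-! ### Sobolev inequality. -/

/-- Fatou on the left, norm convergence of the gradients on the right. This carries both the Sobolev
and the translation estimate from test functions to their limits. -/
theorem eLpNorm_le_of_tendsto_of_le_gradient {r : ℝ≥0∞} {C : ℝ≥0∞} (hC : C ≠ ⊤)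
    (hp : 1 < p) (hG : AEStronglyMeasurable G volume) {φ : ℕ → Euc N → ℝ}
    (hφ : ∀ n, IsTest Ω (φ n))
    (h : Tendsto (fun n => eLpNorm (G - gradient (φ n)) (ENNReal.ofReal p) volume) atTop (𝓝 0))
    {f : ℕ → Euc N → ℝ} {g : Euc N → ℝ} (hf : ∀ n, AEStronglyMeasurable (f n) volume)
    (hfg : ∀ᵐ x, Tendsto (fun n => f n x) atTop (𝓝 (g x)))
    (hle : ∀ n, eLpNorm (f n) r volume ≤ C * eLpNorm (gradient (φ n)) (ENNReal.ofReal p) volume) :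
    eLpNorm g r volume ≤ C * eLpNorm G (ENNReal.ofReal p) volume := by
  have t : Tendsto (fun n => C * (eLpNorm G (ENNReal.ofReal p) volume +
      eLpNorm (G - gradient (φ n)) (ENNReal.ofReal p) volume)) atTop
      (𝓝 (C * eLpNorm G (ENNReal.ofReal p) volume)) := by
    have := ENNReal.Tendsto.const_mul (a := C) (tendsto_const_nhds (x := eLpNorm G
      (ENNReal.ofReal p) volume) |>.add h) (Or.inr hC)
    simpa using this
  refine (Lp.eLpNorm_lim_le_liminf_eLpNorm hf g hfg).trans ?_
  rw [← t.liminf_eq]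
  refine liminf_le_liminf (Eventually.of_forall fun n => (hle n).trans ?_)
  gcongr
  have := eLpNorm_sub_le hG (hG.sub ((hφ n).memLp_gradient 1).1) (one_le_ofReal hp)
  rwa [sub_sub_cancel] at this

/-- Gagliardo–Nirenberg–Sobolev for test functions; boundedness of `Ω` admits subcritical exponents
as well as the critical one. -/
theorem IsTestLimit.exists_eLpNorm_le (hp : 1 < p) (hpN : p < N) (hΩ : Bornology.IsBounded Ω)
    {r : ℝ≥0} (hr : p⁻¹ - (N : ℝ)⁻¹ ≤ (r : ℝ)⁻¹) :
    ∃ C : ℝ≥0, ∀ u G, IsTestLimit p Ω u G →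
      eLpNorm u r volume ≤ C * eLpNorm G (ENNReal.ofReal p) volume := by
  have hp0 : 0 < p := by linarith
  refine ⟨eLpNormLESNormFDerivOfLeConst ℝ volume Ω p.toNNReal r, fun u G hu => ?_⟩
  obtain ⟨φ, hφ, -, h2, h3⟩ := hu.exists_seq hp
  refine eLpNorm_le_of_tendsto_of_le_gradient ENNReal.coe_ne_top hp hu.2.1.1 hφ h2
    (fun n => ((hφ n).memLp 1).1) h3 fun n => ?_
  have hs : (φ n).support ⊆ Ω := (subset_tsupport _).trans (hφ n).2.2
  have := eLpNorm_le_eLpNorm_fderiv_of_le (volume : Measure (Euc N))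
    ((hφ n).1.of_le (by simp)) hs
    (p := p.toNNReal) (q := r) (by simpa using hp.le)
    (by rw [finrank_euclideanSpace_fin, Real.toNNReal_lt_iff_lt_coe hp0.le]; exact_mod_cast hpN)
    (by rw [finrank_euclideanSpace_fin, NNReal.coe_inv, Real.coe_toNNReal _ hp0.le]; exact hr) hΩ
  refine this.trans (le_of_eq ?_)
  congr 1
  exact eLpNorm_congr_norm_ae (ae_of_all _ fun x => (norm_gradient _ _).symm)

/-! ### Translation estimates and the Gagliardo energy. -/

theorem eLpNorm_ofReal_rpow {X E : Type*} [MeasurableSpace X] {μ : Measure X}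
    [NormedAddCommGroup E] (hp : 0 < p) (f : X → E) :
    eLpNorm f (ENNReal.ofReal p) μ ^ p = ∫⁻ x, ‖f x‖ₑ ^ p ∂μ := by
  rw [eLpNorm_eq_lintegral_rpow_enorm_toReal (by simpa using hp) ENNReal.ofReal_ne_top,
    ENNReal.toReal_ofReal hp.le, one_div, ENNReal.rpow_inv_rpow hp.ne']

theorem lintegral_rpow_le_of_isProbabilityMeasure {X : Type*} [MeasurableSpace X] {μ : Measure X}
    [IsProbabilityMeasure μ] (hp : 1 < p) {f : X → ℝ} (hf : AEStronglyMeasurable f μ) :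
    (∫⁻ x, ‖f x‖ₑ ∂μ) ^ p ≤ ∫⁻ x, ‖f x‖ₑ ^ p ∂μ := by
  rw [← eLpNorm_ofReal_rpow (by linarith), ← eLpNorm_one_eq_lintegral_enorm]
  gcongr
  exact eLpNorm_le_eLpNorm_of_exponent_le (one_le_ofReal hp) hf

/-- Fundamental theorem of calculus along the segment from `x` to `x + h`, then Jensen on the unit
interval. -/
theorem IsTest.enorm_sub_rpow_le {φ : Euc N → ℝ} (hφ : IsTest Ω φ) (hp : 1 < p) (x h : Euc N) :
    ‖φ (x + h) - φ x‖ₑ ^ p ≤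
      ‖h‖ₑ ^ p * ∫⁻ t in Ioc (0 : ℝ) 1, ‖gradient φ (x + t • h)‖ₑ ^ p := by
  have hp0 : 0 < p := by linarith
  have hd : ∀ t : ℝ, HasDerivAt (fun t : ℝ => φ (x + t • h)) (fderiv ℝ φ (x + t • h) h) t :=
    fun t => by
      have h1 : HasDerivAt (fun t : ℝ => x + t • h) h t := by
        simpa using ((hasDerivAt_id t).smul_const h).const_add x
      exact (hφ.differentiable (x + t • h)).hasFDerivAt.comp_hasDerivAt t h1
  have hc : Continuous fun t : ℝ => fderiv ℝ φ (x + t • h) h :=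
    (hφ.continuous_fderiv.comp (by fun_prop)).clm_apply continuous_const
  have hg : Continuous fun t : ℝ => ‖gradient φ (x + t • h)‖ :=
    (hφ.continuous_gradient.comp (by fun_prop)).norm
  have e : φ (x + h) - φ x = ∫ t in Ioc (0 : ℝ) 1, fderiv ℝ φ (x + t • h) h := by
    rw [← intervalIntegral.integral_of_le zero_le_one,
      intervalIntegral.integral_eq_sub_of_hasDerivAt (fun t _ => hd t) (hc.intervalIntegrable _ _)]
    simp
  have : IsProbabilityMeasure (volume.restrict (Ioc (0 : ℝ) 1)) := ⟨by simp⟩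
  calc ‖φ (x + h) - φ x‖ₑ ^ p ≤
      (∫⁻ t in Ioc (0 : ℝ) 1, ‖h‖ₑ * ‖‖gradient φ (x + t • h)‖‖ₑ) ^ p := by
        rw [e]
        gcongr
        refine (enorm_integral_le_lintegral_enorm _).trans (lintegral_mono fun t => ?_)
        rw [enorm_norm, mul_comm]
        refine (ContinuousLinearMap.le_opENorm _ _).trans (le_of_eq ?_)
        congr 1
        rw [← ofReal_norm, ← ofReal_norm, norm_gradient]
    _ = ‖h‖ₑ ^ p * (∫⁻ t in Ioc (0 : ℝ) 1, ‖‖gradient φ (x + t • h)‖‖ₑ) ^ p := by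
        rw [lintegral_const_mul _ hg.measurable.enorm, ENNReal.mul_rpow_of_nonneg _ _ hp0.le]
    _ ≤ _ := by
        gcongr
        refine (lintegral_rpow_le_of_isProbabilityMeasure hp hg.aestronglyMeasurable).trans
          (le_of_eq ?_)
        simp only [enorm_norm]

theorem IsTest.eLpNorm_translate_sub_le {φ : Euc N → ℝ} (hφ : IsTest Ω φ) (hp : 1 < p)
    (h : Euc N) : eLpNorm (fun x => φ (x + h) - φ x) (ENNReal.ofReal p) volume ≤
      ‖h‖ₑ * eLpNorm (gradient φ) (ENNReal.ofReal p) volume := by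
  have hp0 : 0 < p := by linarith
  rw [← ENNReal.rpow_le_rpow_iff hp0, ENNReal.mul_rpow_of_nonneg _ _ hp0.le,
    eLpNorm_ofReal_rpow hp0, eLpNorm_ofReal_rpow hp0]
  refine (lintegral_mono fun x => hφ.enorm_sub_rpow_le hp x h).trans ?_
  have hm : Measurable (fun z : Euc N × ℝ => ‖gradient φ (z.1 + z.2 • h)‖ₑ ^ p) :=
    (hφ.continuous_gradient.comp (by fun_prop)).measurable.enorm.pow_const p
  rw [lintegral_const_mul _ hm.lintegral_prod_right', lintegral_lintegral_swap hm.aemeasurable]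
  gcongr
  have : ∀ t : ℝ, ∫⁻ x, ‖gradient φ (x + t • h)‖ₑ ^ p = ∫⁻ x, ‖gradient φ x‖ₑ ^ p := fun t =>
    lintegral_add_right_eq_self (fun x => ‖gradient φ x‖ₑ ^ p) (t • h)
  simp [this]

theorem IsTestLimit.eLpNorm_translate_sub_le (hp : 1 < p) (hu : IsTestLimit p Ω u G)
    (h : Euc N) : eLpNorm (fun x => u (x + h) - u x) (ENNReal.ofReal p) volume ≤
      ‖h‖ₑ * eLpNorm G (ENNReal.ofReal p) volume := by
  obtain ⟨φ, hφ, -, h2, h3⟩ := hu.exists_seq hp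
  refine eLpNorm_le_of_tendsto_of_le_gradient enorm_ne_top hp hu.2.1.1 hφ h2
    (f := fun n x => φ n (x + h) - φ n x) (fun n => ?_) ?_
    fun n => (hφ n).eLpNorm_translate_sub_le hp h
  · have := (hφ n).continuous
    exact Continuous.aestronglyMeasurable (by fun_prop)
  · filter_upwards [h3, (measurePreserving_add_right volume h).quasiMeasurePreserving.ae h3]
      with x hx hx'
    exact hx'.sub hx

/-- In polar coordinates the integrand is `r^(p-ps-1)` near the origin, integrable since `s < 1`,
and `r^(-1-ps)` at infinity, integrable since `s > 0`. -/
theorem integrable_min_rpow_mul_rpow {s : ℝ} (hN : 0 < N) (hp : 0 < p) (hs0 : 0 < s)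
    (hs1 : s < 1) :
    Integrable (fun h : Euc N => min (‖h‖ ^ p) 1 * ‖h‖ ^ (-((N : ℝ) + p * s))) volume := by
  have : Nonempty (Fin N) := ⟨⟨0, hN⟩⟩
  rw [integrable_fun_norm_addHaar (volume : Measure (Euc N))
    (f := fun r => min (r ^ p) 1 * r ^ (-((N : ℝ) + p * s))), finrank_euclideanSpace_fin,
    ← Ioc_union_Ioi_eq_Ioi zero_le_one]
  have hr : ∀ y : ℝ, 0 < y → y ^ (N - 1) = y ^ ((N : ℝ) - 1) := fun y hy => by
    rw [← Real.rpow_natCast, Nat.cast_sub hN, Nat.cast_one]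
  refine IntegrableOn.union ?_ ?_
  · have h1 : IntegrableOn (fun y : ℝ => y ^ (p - p * s - 1)) (Ioc 0 1) volume :=
      (intervalIntegral.intervalIntegrable_rpow' (a := 0) (b := 1) (by nlinarith)).1
    refine h1.congr_fun (fun y hy => ?_) measurableSet_Ioc
    simp only [smul_eq_mul]
    rw [min_eq_left (Real.rpow_le_one hy.1.le hy.2 hp.le), hr y hy.1, ← Real.rpow_add hy.1,
      ← Real.rpow_add hy.1]
    congr 1
    ring
  · have h1 : IntegrableOn (fun y : ℝ => y ^ (-1 - p * s)) (Ioi 1) volume :=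
      integrableOn_Ioi_rpow_of_lt (by nlinarith) one_pos
    refine h1.congr_fun (fun y hy => ?_) measurableSet_Ioi
    have hy0 : 0 < y := one_pos.trans hy
    simp only [smul_eq_mul]
    rw [min_eq_right (Real.one_le_rpow (le_of_lt hy) hp.le), hr y hy0, one_mul,
      ← Real.rpow_add hy0]
    congr 1
    ring

/-- The Gagliardo seminorm of a limit of test functions is finite. -/
theorem IsTestLimit.integrable_gagliardo {s : ℝ} (hN : 0 < N) (hs0 : 0 < s) (hs1 : s < 1)
    (hp : 1 < p) (hu : IsTestLimit p Ω u G) :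
    Integrable (fun z : Euc N × Euc N =>
      |u z.1 - u z.2| ^ p / ‖z.1 - z.2‖ ^ ((N : ℝ) + p * s)) volume := by
  -- Tonelli is easier for a genuinely measurable representative; changing `u` on a null set changes
  -- the integrand only on a null set of the product.
  wlog hm : StronglyMeasurable u generalizing u
  · have h := this (hu.congr hu.1.1.ae_eq_mk (EventuallyEq.refl _ G))
      hu.1.1.stronglyMeasurable_mk
    refine h.congr ?_
    have e1 := Measure.quasiMeasurePreserving_fst (μ := (volume : Measure (Euc N)))
      (ν := (volume : Measure (Euc N))) |>.ae_eq_comp hu.1.1.ae_eq_mk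
    have e2 := Measure.quasiMeasurePreserving_snd (μ := (volume : Measure (Euc N)))
      (ν := (volume : Measure (Euc N))) |>.ae_eq_comp hu.1.1.ae_eq_mk
    filter_upwards [e1, e2] with z h1 h2
    simp only [Function.comp_apply] at h1 h2
    rw [h1, h2]
  have hp0 : 0 < p := by linarith
  set k : Euc N → ℝ := fun h => ‖h‖ ^ (-((N : ℝ) + p * s)) with hk
  have hkm : Measurable k := measurable_norm.pow_const _
  have hum : Measurable u := hm.measurable
  have hm2 : Measurable (fun z : Euc N × Euc N =>
      |u z.1 - u z.2| ^ p / ‖z.1 - z.2‖ ^ ((N : ℝ) + p * s)) := by fun_prop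
  refine ⟨hm2.aestronglyMeasurable, ?_⟩
  have he : ∀ z : Euc N × Euc N, ‖|u z.1 - u z.2| ^ p / ‖z.1 - z.2‖ ^ ((N : ℝ) + p * s)‖ₑ =
      ‖u z.1 - u z.2‖ₑ ^ p * ‖k (z.1 - z.2)‖ₑ := fun z => by
    rw [div_eq_mul_inv, ← Real.rpow_neg (norm_nonneg _), enorm_mul, ← Real.norm_eq_abs,
      Real.enorm_rpow_of_nonneg (norm_nonneg _) hp0.le, enorm_norm]
  have hI := integrable_min_rpow_mul_rpow hN hp0 hs0 hs1
  set A := ∫⁻ x, ‖G x‖ₑ ^ p with hA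
  set D := (2 * eLpNorm u (ENNReal.ofReal p) volume) ^ p with hD
  have hAt : A ≠ ⊤ := by
    rw [hA, ← eLpNorm_ofReal_rpow hp0]
    exact ENNReal.rpow_ne_top_of_nonneg hp0.le hu.2.1.2.ne
  have hDt : D ≠ ⊤ := ENNReal.rpow_ne_top_of_nonneg hp0.le
    (ENNReal.mul_ne_top (by simp) hu.1.2.ne)
  -- Small `h`: the gradient bound. Large `h`: the triangle inequality and translation invariance.
  have hB : ∀ h : Euc N, ∫⁻ y, ‖u (y + h) - u y‖ₑ ^ p ≤
      ‖min (‖h‖ ^ p) 1‖ₑ * (A + D) := fun h => by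
    have b1 : ∫⁻ y, ‖u (y + h) - u y‖ₑ ^ p ≤ ‖h‖ₑ ^ p * A := by
      rw [hA, ← eLpNorm_ofReal_rpow hp0, ← eLpNorm_ofReal_rpow hp0,
        ← ENNReal.mul_rpow_of_nonneg _ _ hp0.le]
      gcongr
      exact hu.eLpNorm_translate_sub_le hp h
    have b2 : ∫⁻ y, ‖u (y + h) - u y‖ₑ ^ p ≤ D := by
      rw [hD, ← eLpNorm_ofReal_rpow hp0]
      gcongr
      have mp := measurePreserving_add_right (volume : Measure (Euc N)) h
      refine (eLpNorm_sub_le (hu.1.1.comp_measurePreserving mp) hu.1.1 (one_le_ofReal hp)).trans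
        (le_of_eq ?_)
      rw [eLpNorm_comp_measurePreserving hu.1.1 mp, two_mul]
    rcases min_cases (‖h‖ ^ p) 1 with ⟨h1, -⟩ | ⟨h1, -⟩
    · rw [h1, Real.enorm_rpow_of_nonneg (norm_nonneg _) hp0.le, enorm_norm]
      refine b1.trans ?_
      gcongr
      exact le_self_add
    · rw [h1]
      simpa using b2.trans le_add_self
  have hF : Measurable (fun z : Euc N × Euc N => ‖u z.1 - u z.2‖ₑ ^ p * ‖k (z.1 - z.2)‖ₑ) := by
    fun_prop
  rw [HasFiniteIntegral]
  simp only [he]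
  rw [Measure.volume_eq_prod, lintegral_prod_symm' _ hF]
  -- Substituting `x = y + h` makes the kernel depend on `h` alone.
  have h1 : ∀ y : Euc N, ∫⁻ x, ‖u x - u y‖ₑ ^ p * ‖k (x - y)‖ₑ =
      ∫⁻ h, ‖u (y + h) - u y‖ₑ ^ p * ‖k h‖ₑ := fun y => by
    rw [← lintegral_add_left_eq_self _ y]
    simp
  simp only [h1]
  rw [lintegral_lintegral_swap (by fun_prop)]
  calc ∫⁻ h, ∫⁻ y, ‖u (y + h) - u y‖ₑ ^ p * ‖k h‖ₑ
      ≤ ∫⁻ h, (A + D) * ‖min (‖h‖ ^ p) 1 * k h‖ₑ := by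
        refine lintegral_mono fun h => ?_
        rw [lintegral_mul_const _ (by fun_prop), enorm_mul]
        calc _ ≤ ‖min (‖h‖ ^ p) 1‖ₑ * (A + D) * ‖k h‖ₑ := by gcongr; exact hB h
          _ = _ := by ring
    _ < ⊤ := by
        rw [lintegral_const_mul' _ _ (ENNReal.add_ne_top.2 ⟨hAt, hDt⟩)]
        exact ENNReal.mul_lt_top (ENNReal.add_lt_top.2 ⟨hAt.lt_top, hDt.lt_top⟩) hI.2

/-! ### Monotonicity inequalities. -/

theorem rpow_sub_two_mul_self (hp : 1 < p) {r : ℝ} (hr : 0 ≤ r) :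
    r ^ (p - 2) * r = r ^ (p - 1) := by
  rcases hr.eq_or_lt with rfl | hr
  · rw [mul_zero, Real.zero_rpow (by linarith)]
  · rw [← Real.rpow_add_one hr.ne']
    congr 1
    ring

/-- The product splits into a radial part, positive when `‖a‖ ≠ ‖b‖` because `r ↦ r^(p-1)` is
strictly increasing, and an angular part controlled by Cauchy–Schwarz. For equal norms, `‖a‖‖b‖ -
⟨a, b⟩ = ‖a - b‖²/2 > 0`. -/
theorem inner_rpow_smul_sub_pos {E : Type*} [NormedAddCommGroup E] [InnerProductSpace ℝ E]
    (hp : 1 < p) {a b : E} (hab : a ≠ b) :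
    0 < inner ℝ (‖a‖ ^ (p - 2) • a - ‖b‖ ^ (p - 2) • b) (a - b) := by
  have e : inner ℝ (‖a‖ ^ (p - 2) • a - ‖b‖ ^ (p - 2) • b) (a - b) =
      (‖a‖ ^ (p - 2) * ‖a‖ - ‖b‖ ^ (p - 2) * ‖b‖) * (‖a‖ - ‖b‖) +
        (‖a‖ ^ (p - 2) + ‖b‖ ^ (p - 2)) * (‖a‖ * ‖b‖ - inner ℝ a b) := by
    simp only [inner_sub_left, inner_sub_right, real_inner_smul_left, real_inner_self_eq_norm_sq,
      real_inner_comm a b]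
    ring
  rw [e, rpow_sub_two_mul_self hp (norm_nonneg a), rpow_sub_two_mul_self hp (norm_nonneg b)]
  have h1 := real_inner_le_norm a b
  have h2 : 0 ≤ ‖a‖ ^ (p - 2) + ‖b‖ ^ (p - 2) := by positivity
  have h3 : 0 ≤ (‖a‖ ^ (p - 2) + ‖b‖ ^ (p - 2)) * (‖a‖ * ‖b‖ - inner ℝ a b) :=
    mul_nonneg h2 (sub_nonneg.2 h1)
  rcases lt_trichotomy ‖a‖ ‖b‖ with h | h | h
  · have := Real.rpow_lt_rpow (norm_nonneg a) h (z := p - 1) (by linarith)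
    nlinarith [mul_pos_of_neg_of_neg (sub_neg.2 this) (sub_neg.2 h)]
  · have hs : 0 < ‖a - b‖ ^ 2 := by
      have := norm_pos_iff.2 (sub_ne_zero.2 hab)
      positivity
    rw [norm_sub_sq_real] at hs
    have ha : 0 < ‖a‖ := by
      rcases (norm_nonneg a).eq_or_lt with h0 | h0
      · rw [norm_eq_zero.1 h0.symm, norm_eq_zero.1 (h.symm.trans h0.symm)] at hab
        exact absurd rfl hab
      · exact h0
    have h4 : 0 < ‖a‖ ^ (p - 2) + ‖b‖ ^ (p - 2) := by positivity
    rw [h, sub_self, zero_mul, zero_add]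
    rw [h] at hs h4
    refine mul_pos h4 ?_
    nlinarith
  · have := Real.rpow_lt_rpow (norm_nonneg b) h (z := p - 1) (by linarith)
    nlinarith [mul_pos (sub_pos.2 this) (sub_pos.2 h)]

theorem rpow_mul_self_sub_mul_nonneg (hp : 1 < p) (a b : ℝ) :
    0 ≤ (|a| ^ (p - 2) * a - |b| ^ (p - 2) * b) * (a - b) := by
  rcases eq_or_ne a b with rfl | h
  · simp
  · have := inner_rpow_smul_sub_pos hp h
    simp only [smul_eq_mul, Real.norm_eq_abs] at this
    rw [mul_comm]
    exact this.le

theorem rpow_mul_self_sub_mul_posPart_nonneg (hp : 1 < p) (a b : ℝ) :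
    0 ≤ (|a| ^ (p - 2) * a - |b| ^ (p - 2) * b) * max (a - b) 0 := by
  rcases le_total (a - b) 0 with h | h
  · rw [max_eq_right h, mul_zero]
  · rw [max_eq_left h]
    exact rpow_mul_self_sub_mul_nonneg hp a b

/-- Both factors have the weak sign of `(a - b) - (c - d)`, which equals `(a - c) - (b - d)`. -/
theorem rpow_mul_self_sub_mul_posPart_sub_nonneg (hp : 1 < p) (a b c d : ℝ) :
    0 ≤ (|a - c| ^ (p - 2) * (a - c) - |b - d| ^ (p - 2) * (b - d)) *
      (max (a - b) 0 - max (c - d) 0) := by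
  have key := rpow_mul_self_sub_mul_nonneg hp (a - c) (b - d)
  rw [show a - c - (b - d) = (a - b) - (c - d) by ring] at key
  set J := |a - c| ^ (p - 2) * (a - c) - |b - d| ^ (p - 2) * (b - d) with hJ
  rcases lt_trichotomy (a - b) (c - d) with h | h | h
  · have h1 : J ≤ 0 := by
      by_contra! hJ
      nlinarith [mul_pos hJ (sub_pos.2 h)]
    exact mul_nonneg_of_nonpos_of_nonpos h1 (sub_nonpos.2 (max_le_max_right 0 h.le))
  · simp [h]
  · have h1 : 0 ≤ J := by
      by_contra! hJ
      nlinarith [mul_pos_of_neg_of_neg hJ (sub_neg.2 h)]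
    exact mul_nonneg h1 (sub_nonneg.2 (max_le_max_right 0 h.le))

/-! ### Integrability of the three terms. -/

/-- A crude Young inequality: replace the smaller of `a`, `b` by the larger. -/
theorem rpow_sub_two_mul_mul_le (hp : 1 < p) {a b : ℝ} (ha : 0 ≤ a) (hb : 0 ≤ b) :
    a ^ (p - 2) * a * b ≤ a ^ p + b ^ p := by
  have hp0 : 0 < p := by linarith
  rw [rpow_sub_two_mul_self hp ha]
  have hap : 0 ≤ a ^ p := by positivity
  have hbp : 0 ≤ b ^ p := by positivity
  have e : ∀ c : ℝ, 0 ≤ c → c ^ (p - 1) * c = c ^ p := fun c hc => by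
    rcases hc.eq_or_lt with rfl | hc
    · rw [mul_zero, Real.zero_rpow hp0.ne']
    · rw [← Real.rpow_add_one hc.ne']
      congr 1
      ring
  rcases le_total a b with h | h
  · calc a ^ (p - 1) * b ≤ b ^ (p - 1) * b := by gcongr
      _ = b ^ p := e b hb
      _ ≤ _ := by linarith
  · calc a ^ (p - 1) * b ≤ a ^ (p - 1) * a := by gcongr
      _ = a ^ p := e a ha
      _ ≤ _ := by linarith

theorem integrable_rpow_mul_inner {X E : Type*} [MeasurableSpace X] {μ : Measure X}
    [NormedAddCommGroup E] [InnerProductSpace ℝ E] (hp : 1 < p) {f g : X → E}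
    (hf : MemLp f (ENNReal.ofReal p) μ) (hg : MemLp g (ENNReal.ofReal p) μ) :
    Integrable (fun x => ‖f x‖ ^ (p - 2) * inner ℝ (f x) (g x)) μ := by
  have hp0 : 0 < p := by linarith
  have hi : ∀ {k : X → E}, MemLp k (ENNReal.ofReal p) μ → Integrable (fun x => ‖k x‖ ^ p) μ :=
    fun hk => by
      have := hk.integrable_norm_rpow (by simpa using hp0) ENNReal.ofReal_ne_top
      rwa [ENNReal.toReal_ofReal hp0.le] at this
  refine ((hi hf).add (hi hg)).mono' ?_ (ae_of_all _ fun x => ?_)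
  · exact (hf.1.norm.aemeasurable.pow_const _).aestronglyMeasurable.mul (hf.1.inner hg.1)
  · rw [norm_mul, Real.norm_of_nonneg (by positivity)]
    calc _ ≤ ‖f x‖ ^ (p - 2) * (‖f x‖ * ‖g x‖) := by gcongr; exact norm_inner_le_norm _ _
      _ = ‖f x‖ ^ (p - 2) * ‖f x‖ * ‖g x‖ := by ring
      _ ≤ _ := rpow_sub_two_mul_mul_le hp (norm_nonneg _) (norm_nonneg _)

theorem norm_rpow_sub_two_mul_mul_le (hp : 1 < p) (a b : ℝ) :
    ‖|a| ^ (p - 2) * a * b‖ ≤ |a| ^ p + |b| ^ p := by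
  rw [norm_mul, norm_mul, Real.norm_of_nonneg (by positivity)]
  exact rpow_sub_two_mul_mul_le hp (abs_nonneg a) (abs_nonneg b)

theorem integrable_nonlocal {s : ℝ} (hN : 0 < N) (hs0 : 0 < s) (hs1 : s < 1) (hp : 1 < p)
    (hu : IsTestLimit p Ω u G) (hv : IsTestLimit p Ω v F) :
    Integrable (fun z : Euc N × Euc N =>
      |u z.1 - u z.2| ^ (p - 2) * (u z.1 - u z.2) * (v z.1 - v z.2) /
        ‖z.1 - z.2‖ ^ ((N : ℝ) + p * s)) volume := by
  have mU : ∀ {w : Euc N → ℝ}, AEStronglyMeasurable w volume →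
      AEMeasurable (fun z : Euc N × Euc N => w z.1 - w z.2) volume := fun hw =>
    (hw.comp_fst.sub hw.comp_snd).aemeasurable
  have m1 := mU hu.1.1
  have m2 := mU hv.1.1
  refine ((hu.integrable_gagliardo hN hs0 hs1 hp).add
    (hv.integrable_gagliardo hN hs0 hs1 hp)).mono' ?_ (ae_of_all _ fun z => ?_)
  · have m3 : Measurable (fun z : Euc N × Euc N => ‖z.1 - z.2‖ ^ ((N : ℝ) + p * s)) := by fun_prop
    exact ((((m1.abs.pow_const _).mul m1).mul m2).div m3.aemeasurable).aestronglyMeasurable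
  · rw [norm_div, Real.norm_of_nonneg (r := ‖z.1 - z.2‖ ^ ((N : ℝ) + p * s)) (by positivity),
      Pi.add_apply, ← add_div]
    gcongr
    exact norm_rpow_sub_two_mul_mul_le hp _ _

/-- Since `s < 1`, the hypothesis gives `pq > N`. With `q'` conjugate to `q`, `1/(pq') = 1/p -
1/(pq)`, so `pq'` is at most the critical Sobolev exponent. -/
theorem exists_sobolev_exponent {s q : ℝ} (hs0 : 0 < s) (hs1 : s < 1) (hp1 : 1 < p)
    (hpN : p < N) (hq : (N : ℝ) / (s * p) < q) :
    1 < q ∧ p⁻¹ - (N : ℝ)⁻¹ ≤ (p * q.conjExponent)⁻¹ := by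
  have hp0 : 0 < p := by linarith
  have hN0 : (0 : ℝ) < N := hp0.trans hpN
  have hsp : 0 < s * p := by positivity
  have h1 : (N : ℝ) < q * (s * p) := (div_lt_iff₀ hsp).1 hq
  have hq0 : 0 < q := (div_pos hN0 hsp).trans hq
  have h2 : (N : ℝ) < q * p := h1.trans (by gcongr; nlinarith)
  have hq1 : 1 < q := by
    by_contra! h
    nlinarith
  refine ⟨hq1, ?_⟩
  rw [mul_inv, ← (Real.HolderConjugate.conjExponent hq1).one_sub_inv, mul_sub, mul_one, ← mul_inv]
  have : (p * q)⁻¹ ≤ (N : ℝ)⁻¹ := by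
    gcongr
    linarith
  linarith

theorem integrable_mul_rpow {q : ℝ} (hp : 0 < p) (hq : 1 < q) {V : Euc N → ℝ}
    (hV : MemLp V (ENNReal.ofReal q) (volume.restrict Ω))
    (hu : MemLp u (ENNReal.ofReal (p * q.conjExponent)) volume) :
    Integrable (fun x => V x * |u x| ^ p) (volume.restrict Ω) := by
  have hc := Real.HolderConjugate.conjExponent hq
  have : ENNReal.HolderConjugate (ENNReal.ofReal q) (ENNReal.ofReal q.conjExponent) :=
    hc.ennrealOfReal
  have h := (hu.restrict Ω).norm_rpow_div (ENNReal.ofReal p)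
  rw [ENNReal.toReal_ofReal hp.le, ← ENNReal.ofReal_div_of_pos hp,
    mul_div_cancel_left₀ _ hp.ne'] at h
  exact hV.integrable_mul h

theorem integrable_potential {q : ℝ} (hp : 1 < p) (hq : 1 < q) {V : Euc N → ℝ}
    (hV : MemLp V (ENNReal.ofReal q) (volume.restrict Ω))
    (hu : MemLp u (ENNReal.ofReal (p * q.conjExponent)) volume)
    (hv : MemLp v (ENNReal.ofReal (p * q.conjExponent)) volume) :
    Integrable (fun x => V x * |u x| ^ (p - 2) * u x * v x) (volume.restrict Ω) := by
  have hp0 : 0 < p := by linarith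
  refine ((integrable_mul_rpow hp0 hq hV hu).norm.add
    (integrable_mul_rpow hp0 hq hV hv).norm).mono' ?_ (ae_of_all _ fun x => ?_)
  · have mu := hu.1.restrict.aemeasurable (μ := volume.restrict Ω)
    have mv := hv.1.restrict.aemeasurable (μ := volume.restrict Ω)
    exact (((hV.1.aemeasurable.mul (mu.abs.pow_const _)).mul mu).mul mv).aestronglyMeasurable
  · rw [show V x * |u x| ^ (p - 2) * u x * v x = V x * (|u x| ^ (p - 2) * u x * v x) by ring,
      norm_mul]
    simp only [Pi.add_apply]
    rw [norm_mul (V x) (|u x| ^ p), norm_mul (V x) (|v x| ^ p), ← mul_add,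
      Real.norm_of_nonneg (r := |u x| ^ p) (by positivity),
      Real.norm_of_nonneg (r := |v x| ^ p) (by positivity)]
    gcongr
    exact norm_rpow_sub_two_mul_mul_le hp _ _

/-- Replaces the gradients picked by choice with the explicit ones, so that the formula for `∇(u -
v)⁺` can be used. -/
theorem H_eq_of_isTestLimit (s : ℝ) (hp : 1 < p) (hΩ : IsOpen Ω) (hu : IsTestLimit p Ω u G)
    (hv : IsTestLimit p Ω v F) :
    H s p Ω u v = (∫ x in Ω, ‖G x‖ ^ (p - 2) * inner ℝ (G x) (F x)) +
      ∫ z : Euc N × Euc N, |u z.1 - u z.2| ^ (p - 2) * (u z.1 - u z.2) * (v z.1 - v z.2) /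
        ‖z.1 - z.2‖ ^ ((N : ℝ) + p * s) := by
  unfold H
  congr 1
  refine setIntegral_congr_ae hΩ.measurableSet ?_
  filter_upwards [hu.weakGradient_ae_eq hp hΩ, hv.weakGradient_ae_eq hp hΩ] with x h1 h2 hx
  rw [h1 hx, h2 hx]

end MixedLaplacian

end

/-! ### The comparison principle. -/

theorem mainTheorem9 {N : ℕ} (s p q : ℝ) (hs0 : 0 < s) (hs1 : s < 1) (hp1 : 1 < p)
    (hpN : p < (N : ℝ)) (hq : (N : ℝ) / (s * p) < q)
    (Ω : Set (EuclideanSpace ℝ (Fin N))) (hΩo : IsOpen Ω) (hΩb : Bornology.IsBounded Ω)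
    (hΩL : MixedLaplacian.HasLipschitzBoundary Ω)
    (V : EuclideanSpace ℝ (Fin N) → ℝ)
    (hV : MemLp V (ENNReal.ofReal q) (volume.restrict Ω))
    (hV0 : ∀ᵐ x ∂volume.restrict Ω, 0 ≤ V x)
    (u v : EuclideanSpace ℝ (Fin N) → ℝ)
    (hu : u ∈ MixedLaplacian.X0 p Ω) (hv : v ∈ MixedLaplacian.X0 p Ω)
    (huv : ∀ ψ ∈ MixedLaplacian.X0 p Ω, (∀ᵐ x ∂volume, 0 ≤ ψ x) →
      MixedLaplacian.H s p Ω u ψ + ∫ x in Ω, V x * |u x| ^ (p - 2) * u x * ψ x ≤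
        MixedLaplacian.H s p Ω v ψ + ∫ x in Ω, V x * |v x| ^ (p - 2) * v x * ψ x)
    (hout : ∀ᵐ x ∂volume.restrict Ωᶜ, u x ≤ v x) :
    ∀ᵐ x ∂volume, u x ≤ v x := by
  open MixedLaplacian in
  have hp0 : 0 < p := by linarith
  have hN : 0 < N := by exact_mod_cast hp0.trans hpN
  have au := isTestLimit_of_mem_X0 hp1 hΩo hu
  have av := isTestLimit_of_mem_X0 hp1 hΩo hv
  set Gu := Ω.indicator (weakGradient Ω u)
  set Gv := Ω.indicator (weakGradient Ω v)
  have aψ := (au.sub hp1 av).posPart hp1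
  set ψ : EuclideanSpace ℝ (Fin N) → ℝ := fun x => max ((u - v) x) 0 with hψ
  set Gψ : EuclideanSpace ℝ (Fin N) → EuclideanSpace ℝ (Fin N) :=
    fun x => (Ioi (0 : ℝ)).indicator (1 : ℝ → ℝ) ((u - v) x) • (Gu - Gv) x with hGψ
  have main := huv ψ (aψ.mem_X0 hp1 hΩo) (ae_of_all _ fun x => le_max_right _ _)
  rw [H_eq_of_isTestLimit s hp1 hΩo au aψ, H_eq_of_isTestLimit s hp1 hΩo av aψ] at main
  obtain ⟨hq1, hr⟩ := exists_sobolev_exponent hs0 hs1 hp1 hpN hq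
  have hr0 : 0 < p * q.conjExponent :=
    mul_pos hp0 (Real.HolderConjugate.conjExponent hq1).symm.pos
  obtain ⟨C, hC⟩ := IsTestLimit.exists_eLpNorm_le hp1 hpN hΩb
    (r := (p * q.conjExponent).toNNReal) (by rwa [Real.coe_toNNReal _ hr0.le])
  have hL : ∀ {w g}, IsTestLimit p Ω w g →
      MemLp w (ENNReal.ofReal (p * q.conjExponent)) volume := fun hw =>
    ⟨hw.1.1, (hC _ _ hw).trans_lt (ENNReal.mul_lt_top ENNReal.coe_lt_top hw.2.1.2)⟩
  have i1 := integrable_rpow_mul_inner hp1 (au.2.1.restrict Ω) (aψ.2.1.restrict Ω)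
  have i2 := integrable_rpow_mul_inner hp1 (av.2.1.restrict Ω) (aψ.2.1.restrict Ω)
  have j1 := integrable_nonlocal hN hs0 hs1 hp1 au aψ
  have j2 := integrable_nonlocal hN hs0 hs1 hp1 av aψ
  have k1 := integrable_potential hp1 hq1 hV (hL au) (hL aψ)
  have k2 := integrable_potential hp1 hq1 hV (hL av) (hL aψ)
  have hj := integral_sub j1 j2
  have hk := integral_sub k1 k2
  have hi := integral_sub i1 i2
  have jpos := le_of_le_of_eq (integral_nonneg fun z => by
    have h1 := rpow_mul_self_sub_mul_posPart_sub_nonneg hp1 (u z.1) (v z.1) (u z.2) (v z.2)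
    have h2 : 0 ≤ ‖z.1 - z.2‖ ^ ((N : ℝ) + p * s) := by positivity
    have h3 := div_nonneg h1 h2
    rw [sub_mul, sub_div] at h3
    exact h3) hj
  have kpos := le_of_le_of_eq (integral_nonneg_of_ae <| hV0.mono fun x hx => by
    have h1 := mul_nonneg hx (rpow_mul_self_sub_mul_posPart_nonneg hp1 (u x) (v x))
    have h2 : V x * ((|u x| ^ (p - 2) * u x - |v x| ^ (p - 2) * v x) * max (u x - v x) 0) =
      V x * |u x| ^ (p - 2) * u x * ψ x - V x * |v x| ^ (p - 2) * v x * ψ x := by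
        simp only [hψ, Pi.sub_apply]
        ring
    rw [h2] at h1
    exact h1) hk
  -- On `{u > v}` the gradient of `ψ` is `Gu - Gv`, elsewhere it is zero; the local integrand is
  -- thus the monotonicity product cut off by the indicator.
  have el : ∀ x, ‖Gu x‖ ^ (p - 2) * inner ℝ (Gu x) (Gψ x) -
      ‖Gv x‖ ^ (p - 2) * inner ℝ (Gv x) (Gψ x) = (Ioi (0 : ℝ)).indicator (1 : ℝ → ℝ) ((u - v) x) *
      inner ℝ (‖Gu x‖ ^ (p - 2) • Gu x - ‖Gv x‖ ^ (p - 2) • Gv x) (Gu x - Gv x) := fun x => by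
    simp only [hGψ, Pi.sub_apply, inner_sub_left, real_inner_smul_left, real_inner_smul_right]
    ring
  have hl0 : ∀ x, 0 ≤ ‖Gu x‖ ^ (p - 2) * inner ℝ (Gu x) (Gψ x) -
      ‖Gv x‖ ^ (p - 2) * inner ℝ (Gv x) (Gψ x) := fun x => by
    rw [el]
    refine mul_nonneg (indicator_nonneg (fun _ _ => zero_le_one) _) ?_
    rcases eq_or_ne (Gu x) (Gv x) with h | h
    · simp [h]
    · exact (inner_rpow_smul_sub_pos hp1 h).le
  -- By `main` the three differences sum to at most zero, and `jpos`, `kpos` discard the other two.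
  have hint : ∫ x in Ω, (‖Gu x‖ ^ (p - 2) * inner ℝ (Gu x) (Gψ x) -
      ‖Gv x‖ ^ (p - 2) * inner ℝ (Gv x) (Gψ x)) = 0 := by
    refine le_antisymm ?_ (integral_nonneg hl0)
    rw [hi]
    linarith
  have hz := (ae_restrict_iff' hΩo.measurableSet).1
    ((integral_eq_zero_iff_of_nonneg hl0 (i1.sub i2)).1 hint)
  have hGψ0 : eLpNorm Gψ (ENNReal.ofReal p) volume = 0 := by
    rw [eLpNorm_eq_zero_iff aψ.2.1.1 (by simpa using hp0)]
    filter_upwards [hz, aψ.gradient_ae_eq_zero hΩo.measurableSet hp1] with x h1 h2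
    by_cases hx : x ∈ Ω
    · have h3 := h1 hx
      simp only [Pi.zero_apply] at h3
      rw [el] at h3
      rcases mul_eq_zero.1 h3 with h | h
      · simp only [hGψ, h, zero_smul, Pi.zero_apply]
      · have : Gu x = Gv x := by
          by_contra hne
          exact (inner_rpow_smul_sub_pos hp1 hne).ne' h
        simp [hGψ, this]
    · exact h2 hx
  -- Sobolev with vanishing gradient norm.
  have hψ0 := hC _ _ aψ
  rw [hGψ0, mul_zero, nonpos_iff_eq_zero,
    eLpNorm_eq_zero_iff aψ.1.1 (by simpa using hr0)] at hψ0
  filter_upwards [hψ0] with x hx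
  have : max ((u - v) x) 0 = 0 := hx
  have := max_eq_right_iff.1 this
  simpa using this
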